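/- Let $G=(V,E)$ be a finite graph, possibly with loops or multiple edges. For $H\subseteq E$ and $v\in V$ let $\deg(H,v)$ be the degree of $v$ in the spanning subgraph $(V,H)$ (a loop at $v$ counts twice), and let $\deg(G,v)=\deg(E,v)$. Given edge weights $\lambda=(\lambda_e)_{e\in E}$ and vertex activities $u=(u^{(v)}_k)$, define $$Z(G,\lambda,u;x)=\sum_{H\subseteq E}\Big(\prod_{e\in H}\lambda_e\Big)\Big(\prod_{v\in V}u^{(v)}_{\deg(H,v)}\,x_v^{\deg(H,v)}\Big),\qquad K_v(z)=\sum_{j=0}^{d}\binom{d}{j}u^{(v)}_j z^j\quad(d=\deg(G,v)),$$ where $K_v$ is called the key polynomial at $v$. The univariate specialization $Z(G,\lambda,u;y^{1/2}\mathbf 1)$, obtained by setting every $x_v=y^{1/2}$, is a polynomial in $y$, namely $\sum_{H\subseteq E}\big(\prod_{e\in H}\lambda_e\big)\big(\prod_{v\in V}u^{(v)}_{\deg(H,v)}\big)y^{|H|}$. For $0<\theta\le\pi$ let $S[\theta]=\{z\in\mathbb C: z\ne 0,\ |\arg z|<\theta\}$, with $-\pi<\arg z\le\pi$. For $A\subseteq\mathbb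 C$, a complex polynomial is called $A$-nonvanishing if it is identically zero, or it is nonzero at every point all of whose coordinates lie in $A$. Statement. For every $\Delta\in\mathbb N$ there is $\varepsilon$ with $0<\varepsilon\le\pi/2$, depending only on $\Delta$, such that the following holds for every finite graph $G=(V,E)$ in which every vertex has degree at most $\Delta$, all nonnegative real edge weights $\lambda$, and all functions $f,g:V\to\mathbb N$ with $f(v)\le g(v)\le f(v)+3$ for every $v\in V$. Let $u^{(v)}_k=1$ if $f(v)\le k\le g(v)$ and $u^{(v)}_k=0$ otherwise. Then: 1. for every $v\in V$, the key polynomial $K_v(z)$ is $S[\pi/2+\varepsilon]$-nonvanishing; 2. $Z(G,\lambda,u;x)$ is $S[\varepsilon]$-nonvanishing; 3. $Z(G,\lambda,u;y^{1/2}\mathbf 1)$ is $S[2\varepsilon]$-nonvanishing as a polynomial in $y$. -/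

import Mathlib

open scoped Graph

noncomputable section

namespace SpanningSubgraph

/-- A polynomial in several complex variables is `A`-nonvanishing if it is identically zero, or it
does not vanish at any point all of whose coordinates lie in `A`. -/
def Nonvanishing {σ : Type*} (A : Set ℂ) (F : MvPolynomial σ ℂ) : Prop :=
  F = 0 ∨ ∀ z : σ → ℂ, (∀ i, z i ∈ A) → MvPolynomial.eval z F ≠ 0

/-- `A`-nonvanishing for polynomials in one variable. -/
def Nonvanishing₁ (A : Set ℂ) (F : Polynomial ℂ) : Prop :=
  F = 0 ∨ ∀ z ∈ A, F.eval z ≠ 0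

/-- The open sector `S[θ]` centered on the positive real axis. -/
def sector (θ : ℝ) : Set ℂ := {z | z ≠ 0 ∧ |Complex.arg z| < θ}

section Graphs

variable {α β : Type*} (G : Graph α β)

open Classical in
/-- `deg(H, v)`: the degree of the vertex `v` in the spanning subgraph with edge set `H`. A loop
at `v` contributes two. -/
def deg (H : Finset E(G)) (v : V(G)) : ℕ :=
  ∑ e ∈ H, if G.IsLoopAt e v then 2 else if G.Inc e v then 1 else 0

variable [Fintype E(G)]

/-- The key polynomial `K_v(z) = ∑_{j=0}^d binom(d,j) u_j^{(v)} z^j`, with `d = deg(G,v)`. -/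
def keyPoly (u : V(G) → ℕ → ℂ) (v : V(G)) : Polynomial ℂ :=
  ∑ j ∈ Finset.range (deg G Finset.univ v + 1),
    Polynomial.C (((deg G Finset.univ v).choose j : ℂ) * u v j) * Polynomial.X ^ j

variable [Fintype V(G)]

/-- The product of `λ^H = ∏_{e ∈ H} λ_e` and `u_{deg(H)} = ∏_v u^{(v)}_{deg(H,v)}`. -/
def weight (lam : E(G) → ℂ) (u : V(G) → ℕ → ℂ) (H : Finset E(G)) : ℂ :=
  (∏ e ∈ H, lam e) * ∏ v : V(G), u v (deg G H v)

/-- `Z(G, λ, u; x) = ∑_{H ⊆ E} λ^H u_{deg(H)} x^{deg(H)}`. -/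
def Z (lam : E(G) → ℂ) (u : V(G) → ℕ → ℂ) : MvPolynomial V(G) ℂ :=
  ∑ H : Finset E(G), MvPolynomial.C (weight G lam u H) *
    ∏ v : V(G), MvPolynomial.X v ^ deg G H v

/-- The univariate specialization `Z(G, λ, u; y^{1/2} 1) = ∑_{H ⊆ E} λ^H u_{deg(H)} y^{|H|}`,
as a polynomial in `y`; see `Z_uni_eval` for the agreement with the substitution. -/
def Z_uni (lam : E(G) → ℂ) (u : V(G) → ℕ → ℂ) : Polynomial ℂ :=
  ∑ H : Finset E(G), Polynomial.C (weight G lam u H) * Polynomial.X ^ H.card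

theorem sum_deg (H : Finset E(G)) : ∑ v : V(G), deg G H v = 2 * H.card := by
  classical
  unfold deg
  rw [Finset.sum_comm, Finset.sum_congr rfl (g := fun _ => 2), Finset.sum_const, smul_eq_mul,
    mul_comm]
  intro e _
  obtain ⟨x, y, h⟩ := Graph.exists_isLink_of_mem_edgeSet e.2
  by_cases hxy : x = y
  · subst hxy
    rw [Finset.sum_eq_single (⟨x, h.left_mem⟩ : V(G))]
    · exact if_pos h
    · intro v _ hv
      have hn : ¬ G.Inc e v := fun h' => hv (Subtype.ext (by
        rcases h'.eq_or_eq_of_isLink h with h1 | h1 <;> exact h1))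
      rw [if_neg (fun h' => hn h'.inc), if_neg hn]
    · simp
  · have hl : ∀ v : V(G), ¬ G.IsLoopAt e v := fun v hv =>
      hxy ((hv.eq_of_inc h.inc_left).symm.trans (hv.eq_of_inc h.inc_right))
    rw [Finset.sum_eq_add (⟨x, h.left_mem⟩ : V(G)) ⟨y, h.right_mem⟩]
    · rw [if_neg (hl _), if_neg (hl _), if_pos h.inc_left, if_pos h.inc_right]
    · exact fun h' => hxy (congrArg Subtype.val h')
    · intro v _ hv
      rw [if_neg (hl _), if_neg]
      intro h'
      rcases h'.eq_or_eq_of_isLink h with h1 | h1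
      · exact hv.1 (Subtype.ext h1)
      · exact hv.2 (Subtype.ext h1)
    · simp
    · simp

theorem Z_uni_eval_sq (lam : E(G) → ℂ) (u : V(G) → ℕ → ℂ) (w : ℂ) :
    (Z_uni G lam u).eval (w ^ 2) = MvPolynomial.eval (fun _ => w) (Z G lam u) := by
  simp only [Z_uni, Z, Polynomial.eval_finsetSum, map_sum, map_mul, map_prod, map_pow,
    Polynomial.eval_mul, Polynomial.eval_pow, Polynomial.eval_C, Polynomial.eval_X,
    MvPolynomial.eval_C, MvPolynomial.eval_X, Finset.prod_pow_eq_pow_sum, sum_deg, pow_mul]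

theorem Z_uni_eval (lam : E(G) → ℂ) (u : V(G) → ℕ → ℂ) (y : ℂ) :
    (Z_uni G lam u).eval y = MvPolynomial.eval (fun _ => y ^ (1 / 2 : ℂ)) (Z G lam u) := by
  rw [← Z_uni_eval_sq]
  congr 1
  rw [← Complex.cpow_nat_mul]
  simp

end Graphs

/-- The indicator activities: `u_k^{(v)} = 1` if `f(v) ≤ k ≤ g(v)`, and `0` otherwise. -/
def indicatorActivity {V : Type*} (f g : V → ℕ) (v : V) (k : ℕ) : ℂ :=
  if f v ≤ k ∧ k ≤ g v then 1 else 0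

end SpanningSubgraph

end

/-!
When `u v k = t v ^ k` with `Re (t v) > 0`, the sum over spanning subgraphs factors as
`∏ (1 + λ_e t_x t_y)` over the edges `e = xy`, and no factor vanishes because `t_x t_y` is never a
negative real. Grace's theorem (deduced from Laguerre's theorem on polar derivatives) allows the
powers `t v ^ k` to be replaced, one vertex at a time, by activities whose key polynomial has full
degree and no zeros in the closed right half-plane. Rescaling the activities at `v` by the powers of
`x v ∈ S[ε]` turns nonvanishing in `S[π/2 + ε]` into this condition. The degenerate activities are
limits of such ones, and nonvanishing on an open set passes to limits of polynomials of bounded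
degree.

A window of at most four consecutive binomial coefficients gives, up to a power of `z`, a polynomial
of degree at most three which satisfies the Hurwitz criterion because
`C(d,k) C(d,k+3) < C(d,k+1) C(d,k+2)`. So it has no zeros in the closed right half-plane except `0`,
hence none in a slightly larger sector, and for bounded `d` there are finitely many windows.
-/

namespace SpanningSubgraph

open Polynomial Filter Topology

/-! ### Grace's theorem -/

theorem ofReal_add_mul_ne_zero {r : ℝ} (hr : 0 < r) {z w : ℂ} (hz : 0 ≤ z.re) (hw : 0 < w.re) :
    (r : ℂ) + z * w ≠ 0 := by
  intro h
  have hw0 : w ≠ 0 := fun h0 => hw.ne' (by rw [h0, Complex.zero_re])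
  have hzw : z = -r * w⁻¹ := by
    field_simp
    linear_combination h
  have hre : z.re = -(r * (w.re / Complex.normSq w)) := by
    rw [hzw, ← Complex.ofReal_neg, Complex.re_ofReal_mul, Complex.inv_re, neg_mul]
  have := mul_pos hr (div_pos hw (Complex.normSq_pos.2 hw0))
  linarith

/-- Inversion maps the half-plane `x ≤ Re z` into a closed disk, which is convex. -/
theorem norm_two_mul_inv_sub_one_le_one_iff {x : ℝ} (hx : 0 < x) {z : ℂ} (hz : z ≠ 0) :
    ‖2 * x * z⁻¹ - 1‖ ≤ 1 ↔ x ≤ z.re := by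
  have h : 2 * x * z⁻¹ - 1 = (2 * x - z) / z := by field_simp
  rw [h, norm_div, div_le_one (norm_pos_iff.2 hz), ← sq_le_sq₀ (norm_nonneg _) (norm_nonneg _),
    Complex.sq_norm, Complex.sq_norm, Complex.normSq_sub]
  simp only [map_mul, Complex.normSq_ofReal, Complex.normSq_ofNat, Complex.mul_re,
    Complex.mul_im, Complex.conj_re, Complex.conj_im, Complex.ofReal_re, Complex.ofReal_im,
    Complex.re_ofNat, Complex.im_ofNat]
  constructor <;> intro h <;> nlinarith

theorem norm_sum_sub_natCast_le {s : Multiset ℂ} {d : ℕ} (hs : ∀ w ∈ s, ‖w - 1‖ ≤ 1)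
    (hd : s.card ≤ d) : ‖s.sum - d‖ ≤ d := by
  have hcard : ‖s.sum - s.card‖ ≤ s.card := by
    have h := norm_multiset_sum_le (s.map fun w => w - 1)
    rw [Multiset.sum_map_sub, Multiset.map_id', Multiset.map_const', Multiset.sum_replicate,
      nsmul_one, Multiset.map_map] at h
    refine h.trans ((Multiset.sum_le_card_nsmul _ 1 ?_).trans (by simp))
    simpa using hs
  obtain ⟨m, rfl⟩ := Nat.exists_eq_add_of_le hd
  calc ‖s.sum - (s.card + m : ℕ)‖ = ‖(s.sum - s.card) - m‖ := by
        push_cast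
        rw [sub_sub]
    _ ≤ s.card + m := (norm_sub_le _ _).trans (by rw [Complex.norm_natCast]; gcongr)
    _ = (s.card + m : ℕ) := by push_cast; rfl

/-- The polar derivative of `p`, regarded as a polynomial of degree `d`, with pole `b`. -/
noncomputable def polarDerivative (d : ℕ) (b : ℂ) (p : ℂ[X]) : ℂ[X] :=
  (d : ℂ[X]) * p + (C b - X) * derivative p

theorem coeff_polarDerivative (d : ℕ) (b : ℂ) (p : ℂ[X]) (j : ℕ) :
    (polarDerivative d b p).coeff j = (d - j) * p.coeff j + b * ((j + 1) * p.coeff (j + 1)) := by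
  rw [polarDerivative, coeff_add, sub_mul, coeff_sub, coeff_C_mul, coeff_natCast_mul]
  cases j with
  | zero => simp [coeff_derivative]
  | succ j =>
    rw [coeff_X_mul, coeff_derivative, coeff_derivative]
    push_cast
    ring

theorem natDegree_polarDerivative_le {d : ℕ} (b : ℂ) {p : ℂ[X]} (hp : p.natDegree ≤ d + 1) :
    (polarDerivative (d + 1) b p).natDegree ≤ d := by
  refine natDegree_le_iff_coeff_eq_zero.2 fun j hj => ?_
  rw [coeff_polarDerivative, coeff_eq_zero_of_natDegree_lt (n := j + 1) (by omega)]
  rcases eq_or_ne j (d + 1) with rfl | hne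
  · simp
  · rw [coeff_eq_zero_of_natDegree_lt (n := j) (by omega)]
    simp

/-- Laguerre's theorem. At a zero `t`, the inverse `(t - b)⁻¹` would be an average of `d` points,
each equal to `(t - z)⁻¹` for a root `z` or to `0`; all of them lie in the disk that is the image
of the half-plane `Re t ≤ Re w` under inversion, whereas `(t - b)⁻¹` does not. -/
theorem eval_polarDerivative_ne_zero {d : ℕ} (hd : 0 < d) {p : ℂ[X]} (hpd : p.natDegree ≤ d)
    (hp : ∀ t : ℂ, 0 < t.re → p.eval t ≠ 0) {b t : ℂ} (hb : 0 < b.re) (ht : 0 < t.re) :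
    (polarDerivative d b p).eval t ≠ 0 := by
  intro h0
  simp only [polarDerivative, eval_add, eval_mul, eval_sub, eval_natCast, eval_C, eval_X] at h0
  have hd0 : (d : ℂ) ≠ 0 := Nat.cast_ne_zero.2 hd.ne'
  have hlog := (IsAlgClosed.splits p).eval_derivative_div_eval_of_ne_zero (hp t ht)
  set S : ℂ := (p.roots.map fun z => 1 / (t - z)).sum
  have hS : (t - b) * S = d := by
    rw [← hlog]
    field_simp [hp t ht]
    linear_combination -h0
  have htb : t - b ≠ 0 := left_ne_zero_of_mul (hS.trans_ne hd0)
  have hdisk : ‖2 * t.re * S - d‖ ≤ d := by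
    rw [← Multiset.sum_map_mul_left]
    refine norm_sum_sub_natCast_le ?_ (by simpa using (card_roots' p).trans hpd)
    simp only [Multiset.mem_map, forall_exists_index, and_imp, forall_apply_eq_imp_iff₂]
    intro z hz
    have hzre : z.re ≤ 0 := by
      by_contra! hz0
      exact hp z hz0 (isRoot_of_mem_roots hz)
    have htz : t.re ≤ (t - z).re := by
      rw [Complex.sub_re]
      linarith
    have htz0 : t - z ≠ 0 := fun h => by
      rw [h, Complex.zero_re] at htz
      linarith
    rw [one_div]
    exact (norm_two_mul_inv_sub_one_le_one_iff ht htz0).2 htz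
  have hpole : ‖2 * t.re * (t - b)⁻¹ - 1‖ ≤ 1 := by
    have hfactor : 2 * t.re * S - d = d * (2 * t.re * (t - b)⁻¹ - 1) := by
      rw [eq_div_of_mul_eq htb ((mul_comm _ _).trans hS)]
      ring
    rw [hfactor, norm_mul, Complex.norm_natCast] at hdisk
    exact le_of_mul_le_mul_left (hdisk.trans_eq (mul_one _).symm) (Nat.cast_pos.2 hd)
  have := (norm_two_mul_inv_sub_one_le_one_iff ht htb).1 hpole
  rw [Complex.sub_re] at this
  linarith

/-- The key polynomial of an activity sequence `a` at a vertex of degree `d`, without reference to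
a graph. -/
noncomputable def binomialPoly (d : ℕ) (a : ℕ → ℂ) : ℂ[X] :=
  ∑ j ∈ Finset.range (d + 1), C ((d.choose j : ℂ) * a j) * X ^ j

theorem coeff_binomialPoly (d : ℕ) (a : ℕ → ℂ) (j : ℕ) :
    (binomialPoly d a).coeff j = d.choose j * a j := by
  simp only [binomialPoly, finsetSum_coeff, coeff_C_mul_X_pow, Finset.sum_ite_eq,
    Finset.mem_range, Nat.lt_succ_iff]
  split_ifs with hj
  · rfl
  · rw [Nat.choose_eq_zero_of_lt (not_le.1 hj), Nat.cast_zero, zero_mul]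

theorem natDegree_binomialPoly_le (d : ℕ) (a : ℕ → ℂ) : (binomialPoly d a).natDegree ≤ d := by
  refine natDegree_le_iff_coeff_eq_zero.2 fun j hj => ?_
  rw [coeff_binomialPoly, Nat.choose_eq_zero_of_lt hj, Nat.cast_zero, zero_mul]

theorem eval_binomialPoly_mul_pow (d : ℕ) (a : ℕ → ℂ) (x z : ℂ) :
    (binomialPoly d fun j => a j * x ^ j).eval z = (binomialPoly d a).eval (x * z) := by
  simp [binomialPoly, eval_finsetSum, mul_pow, mul_assoc]

theorem binomialPoly_add_sub_div_choose {d : ℕ} (a : ℕ → ℂ) {q : ℂ[X]} (hq : q.natDegree ≤ d) :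
    binomialPoly d (fun j => a j + (q - binomialPoly d a).coeff j / d.choose j) = q := by
  ext j
  rw [coeff_binomialPoly, coeff_sub, coeff_binomialPoly]
  rcases le_or_gt j d with hj | hj
  · have : (d.choose j : ℂ) ≠ 0 := Nat.cast_ne_zero.2 (Nat.choose_pos hj).ne'
    field_simp
    ring
  · rw [Nat.choose_eq_zero_of_lt hj, coeff_eq_zero_of_natDegree_lt (hq.trans_lt hj), Nat.cast_zero,
      zero_mul]

theorem exists_binomialPoly_eq {d : ℕ} {q : ℂ[X]} (hq : q.natDegree ≤ d) :
    ∃ a, binomialPoly d a = q :=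
  ⟨_, binomialPoly_add_sub_div_choose 0 hq⟩

/-- The linear functional `X ^ j ↦ a j`: it replaces the powers of the variable by activities. -/
noncomputable def umbralEval (a : ℕ → ℂ) : ℂ[X] →ₗ[ℂ] ℂ :=
  lsum fun j => a j • LinearMap.id

theorem umbralEval_monomial (a : ℕ → ℂ) (j : ℕ) (c : ℂ) :
    umbralEval a (monomial j c) = a j * c := by
  simp [umbralEval, lsum_apply, sum_monomial_index]

theorem umbralEval_eq_sum {a : ℕ → ℂ} {d : ℕ} {p : ℂ[X]} (hp : p.natDegree ≤ d) :
    umbralEval a p = ∑ j ∈ Finset.range (d + 1), a j * p.coeff j := by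
  rw [umbralEval, lsum_apply, p.sum_over_range' (by simp) (d + 1) (Nat.lt_succ_of_le hp)]
  simp only [LinearMap.smul_apply, LinearMap.id_apply, smul_eq_mul]

theorem umbralEval_pow (z : ℂ) (p : ℂ[X]) : umbralEval (fun j => z ^ j) p = p.eval z := by
  simp [umbralEval, lsum_apply, eval_eq_sum, mul_comm]

theorem succ_mul_eq_of_binomialPoly_eq {d : ℕ} {a s : ℕ → ℂ} {b : ℂ}
    (h : binomialPoly (d + 1) a = (1 + C b * X) * binomialPoly d s) {j : ℕ} (hj : j ≤ d + 1) :
    (d + 1) * a j = (d + 1 - j) * s j + b * (j * s (j - 1)) := by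
  have hcoeff := congrArg (coeff · j) h
  simp only [add_mul, one_mul, mul_assoc, coeff_add, coeff_C_mul, coeff_binomialPoly] at hcoeff
  have hpos : ((d + 1).choose j : ℂ) ≠ 0 := Nat.cast_ne_zero.2 (Nat.choose_pos hj).ne'
  have hdiag : (d.choose j : ℂ) * (d + 1) = (d + 1).choose j * (d + 1 - j) := by
    have := congrArg (Nat.cast : ℕ → ℂ) (Nat.choose_mul_succ_eq d j)
    push_cast [Nat.cast_sub hj] at this
    exact this
  apply mul_left_cancel₀ hpos
  cases j with
  | zero =>
    simp only [mul_coeff_zero, coeff_X_zero, zero_mul, mul_zero, add_zero] at hcoeff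
    push_cast at *
    linear_combination (d + 1 : ℂ) * hcoeff + s 0 * hdiag
  | succ j =>
    rw [coeff_X_mul, coeff_binomialPoly] at hcoeff
    have hshift : (d + 1 : ℂ) * d.choose j = (d + 1).choose (j + 1) * (j + 1) := by
      exact_mod_cast Nat.add_one_mul_choose_eq d j
    push_cast [Nat.add_sub_cancel] at *
    linear_combination (d + 1 : ℂ) * hcoeff + s (j + 1) * hdiag + b * s j * hshift

theorem succ_mul_umbralEval {d : ℕ} {a s : ℕ → ℂ} {b : ℂ}
    (h : binomialPoly (d + 1) a = (1 + C b * X) * binomialPoly d s) {p : ℂ[X]}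
    (hp : p.natDegree ≤ d + 1) :
    (d + 1) * umbralEval a p = umbralEval s (polarDerivative (d + 1) b p) := by
  rw [umbralEval_eq_sum hp, umbralEval_eq_sum (natDegree_polarDerivative_le b hp)]
  calc (d + 1) * ∑ j ∈ Finset.range (d + 1 + 1), a j * p.coeff j
      = ∑ j ∈ Finset.range (d + 1 + 1), (d + 1 - j) * (s j * p.coeff j)
        + ∑ j ∈ Finset.range (d + 1 + 1), b * (j * (s (j - 1) * p.coeff j)) := by
        rw [Finset.mul_sum, ← Finset.sum_add_distrib]
        refine Finset.sum_congr rfl fun j hj => ?_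
        have := succ_mul_eq_of_binomialPoly_eq h (Nat.lt_succ_iff.1 (Finset.mem_range.1 hj))
        linear_combination p.coeff j * this
    _ = ∑ j ∈ Finset.range (d + 1), (d + 1 - j) * (s j * p.coeff j)
        + ∑ j ∈ Finset.range (d + 1), b * ((j + 1) * (s j * p.coeff (j + 1))) := by
        rw [Finset.sum_range_succ, Finset.sum_range_succ' (fun j : ℕ => b * _)]
        simp
    _ = ∑ j ∈ Finset.range (d + 1), s j * (polarDerivative (d + 1) b p).coeff j := by
        rw [← Finset.sum_add_distrib]
        refine Finset.sum_congr rfl fun j _ => ?_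
        rw [coeff_polarDerivative]
        push_cast
        ring

/-- A root `ρ` splits off the factor `1 - ρ⁻¹ X`. -/
theorem exists_binomialPoly_succ_eq {d : ℕ} {a : ℕ → ℂ} (had : a (d + 1) ≠ 0)
    (ha : ∀ z : ℂ, 0 ≤ z.re → (binomialPoly (d + 1) a).eval z ≠ 0) :
    ∃ (b : ℂ) (s : ℕ → ℂ), 0 < b.re ∧ s d ≠ 0 ∧
      binomialPoly (d + 1) a = (1 + C b * X) * binomialPoly d s := by
  have hdeg : (binomialPoly (d + 1) a).natDegree = d + 1 :=
    natDegree_eq_of_le_of_coeff_ne_zero (natDegree_binomialPoly_le _ _)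
      (by simpa [coeff_binomialPoly] using had)
  obtain ⟨ρ, hρ⟩ := IsAlgClosed.exists_root (binomialPoly (d + 1) a)
    (degree_ne_of_natDegree_ne (hdeg.trans_ne d.succ_ne_zero))
  have hρre : ρ.re < 0 := not_le.1 fun h => ha ρ h hρ
  have hρ0 : ρ ≠ 0 := fun h => hρre.ne (by rw [h, Complex.zero_re])
  obtain ⟨q, hq⟩ := dvd_iff_isRoot.2 hρ
  have hqd : (C (-ρ) * q).natDegree ≤ d := by
    rw [natDegree_C_mul (neg_ne_zero.2 hρ0)]
    have hq0 : q ≠ 0 := fun h => by simp [hq, h] at hdeg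
    rw [hq, natDegree_mul (X_sub_C_ne_zero ρ) hq0, natDegree_X_sub_C] at hdeg
    omega
  obtain ⟨s, hs⟩ := exists_binomialPoly_eq hqd
  have hfactor : binomialPoly (d + 1) a = (1 + C (-ρ⁻¹) * X) * binomialPoly d s := by
    have hC : C ρ⁻¹ * C ρ = 1 := by rw [← C_mul, inv_mul_cancel₀ hρ0, C_1]
    rw [hs, hq, C_neg, C_neg]
    linear_combination (-X * q) * hC
  refine ⟨-ρ⁻¹, s, ?_, fun hsd => ?_, hfactor⟩
  · rw [Complex.neg_re, Complex.inv_re, ← neg_div]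
    exact div_pos (neg_pos.2 hρre) (Complex.normSq_pos.2 hρ0)
  · have htop := succ_mul_eq_of_binomialPoly_eq hfactor le_rfl
    simp [hsd, had, Nat.cast_add_one_ne_zero] at htop

/-- Grace's apolarity theorem for the right half-plane. -/
theorem umbralEval_ne_zero {d : ℕ} {a : ℕ → ℂ} {p : ℂ[X]} (had : a d ≠ 0)
    (ha : ∀ z : ℂ, 0 ≤ z.re → (binomialPoly d a).eval z ≠ 0) (hpd : p.natDegree ≤ d)
    (hp : ∀ t : ℂ, 0 < t.re → p.eval t ≠ 0) : umbralEval a p ≠ 0 := by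
  induction d generalizing a p with
  | zero =>
    obtain ⟨c, rfl⟩ := natDegree_eq_zero.1 (Nat.le_zero.1 hpd)
    have hc : c ≠ 0 := by simpa using hp 1 (by simp)
    rw [← monomial_zero_left, umbralEval_monomial]
    exact mul_ne_zero had hc
  | succ d ih =>
    obtain ⟨b, s, hb, hsd, hfactor⟩ := exists_binomialPoly_succ_eq had ha
    have hs : ∀ z : ℂ, 0 ≤ z.re → (binomialPoly d s).eval z ≠ 0 := fun z hz h0 =>
      ha z hz (by rw [hfactor, eval_mul, h0, mul_zero])
    have hpolar := ih hsd hs (natDegree_polarDerivative_le b hpd) fun t ht =>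
      eval_polarDerivative_ne_zero d.succ_pos hpd hp hb ht
    rw [← succ_mul_umbralEval hfactor hpd] at hpolar
    exact right_ne_zero_of_mul hpolar

/-! ### Vertex-by-vertex replacement -/

section Graphs

variable {α β : Type*} (G : Graph α β)

theorem deg_mono {H₁ H₂ : Finset E(G)} (h : H₁ ⊆ H₂) (v : V(G)) : deg G H₁ v ≤ deg G H₂ v :=
  Finset.sum_le_sum_of_subset h

theorem sum_deg_singleton (H : Finset E(G)) (v : V(G)) : ∑ e ∈ H, deg G {e} v = deg G H v :=
  Finset.sum_congr rfl fun _ _ => Finset.sum_singleton ..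

open Classical in
theorem deg_singleton {e : E(G)} {x y : V(G)} (h : G.IsLink e x y) (v : V(G)) :
    deg G {e} v = (if x = v then 1 else 0) + (if y = v then 1 else 0) := by
  have hinc : G.Inc e v ↔ x = v ∨ y = v := by
    constructor
    · intro hv
      exact (hv.eq_or_eq_of_isLink h).imp (Subtype.ext ·.symm) (Subtype.ext ·.symm)
    · rintro (rfl | rfl)
      exacts [h.inc_left, h.inc_right]
  have hloop : G.IsLoopAt e v ↔ x = v ∧ y = v := by
    constructor
    · intro hv
      exact ⟨Subtype.ext (hv.eq_of_inc h.inc_left).symm,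
        Subtype.ext (hv.eq_of_inc h.inc_right).symm⟩
    · rintro ⟨rfl, rfl⟩
      exact h
  simp only [deg, Finset.sum_singleton, hinc, hloop]
  by_cases hx : x = v <;> by_cases hy : y = v <;> simp [hx, hy]

theorem keyPoly_eq_binomialPoly [Fintype E(G)] (u : V(G) → ℕ → ℂ) (v : V(G)) :
    keyPoly G u v = binomialPoly (deg G Finset.univ v) (u v) :=
  rfl

variable [Fintype V(G)]

theorem prod_pow_deg_singleton {e : E(G)} {x y : V(G)} (h : G.IsLink e x y) (t : V(G) → ℂ) :
    ∏ v, t v ^ deg G {e} v = t x * t y := by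
  classical
  simp only [deg_singleton G h, pow_add, Finset.prod_mul_distrib, pow_ite, pow_one, pow_zero,
    Finset.prod_ite_eq, Finset.mem_univ, if_true]

variable [Fintype E(G)]

theorem sum_weight_pow (lam : E(G) → ℂ) (t : V(G) → ℂ) :
    ∑ H, weight G lam (fun v k => t v ^ k) H = ∏ e, (1 + lam e * ∏ v, t v ^ deg G {e} v) := by
  rw [Finset.prod_one_add, Finset.powerset_univ]
  refine Finset.sum_congr rfl fun H _ => ?_
  rw [weight, Finset.prod_mul_distrib, Finset.prod_comm]
  simp only [Finset.prod_pow_eq_pow_sum, sum_deg_singleton]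

theorem sum_weight_pow_ne_zero {lam : E(G) → ℝ} (hlam : ∀ e, 0 ≤ lam e) {t : V(G) → ℂ}
    (ht : ∀ v, 0 < (t v).re) :
    ∑ H, weight G (fun e => (lam e : ℂ)) (fun v k => t v ^ k) H ≠ 0 := by
  rw [sum_weight_pow, Finset.prod_ne_zero_iff]
  intro e _
  obtain ⟨x, y, h⟩ := Graph.exists_isLink_of_mem_edgeSet e.2
  lift x to V(G) using h.left_mem
  lift y to V(G) using h.right_mem
  rw [prod_pow_deg_singleton G h, ← mul_assoc, ← Complex.ofReal_one]
  refine ofReal_add_mul_ne_zero one_pos ?_ (ht y)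
  rw [Complex.re_ofReal_mul]
  exact mul_nonneg (hlam e) (ht x).le

open Classical in
theorem exists_umbralEval_eq_sum_weight (lam : E(G) → ℂ) (u : V(G) → ℕ → ℂ) (a : V(G)) :
    ∃ p : ℂ[X], p.natDegree ≤ deg G Finset.univ a ∧
      ∀ w, umbralEval w p = ∑ H, weight G lam (Function.update u a w) H := by
  refine ⟨∑ H, monomial (deg G H a)
      ((∏ e ∈ H, lam e) * ∏ v ∈ Finset.univ.erase a, u v (deg G H v)), ?_, fun w => ?_⟩
  · exact natDegree_sum_le_of_forall_le _ _ fun H _ =>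
      (natDegree_monomial_le _).trans (deg_mono G H.subset_univ a)
  · rw [map_sum]
    refine Finset.sum_congr rfl fun H _ => ?_
    have hrest : ∏ v ∈ Finset.univ.erase a, Function.update u a w v (deg G H v)
        = ∏ v ∈ Finset.univ.erase a, u v (deg G H v) :=
      Finset.prod_congr rfl fun v hv => by rw [Function.update_of_ne (Finset.ne_of_mem_erase hv)]
    rw [umbralEval_monomial, weight, ← Finset.mul_prod_erase _ _ (Finset.mem_univ a),
      Function.update_self, hrest, mul_left_comm]

/-- The powers `t v ^ k` are replaced by the activities `u v k` one vertex at a time. -/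
theorem sum_weight_ne_zero {lam : E(G) → ℝ} (hlam : ∀ e, 0 ≤ lam e) {u : V(G) → ℕ → ℂ}
    (hu : ∀ v, u v (deg G Finset.univ v) ≠ 0)
    (hK : ∀ v, ∀ z : ℂ, 0 ≤ z.re → (keyPoly G u v).eval z ≠ 0) :
    ∑ H, weight G (fun e => (lam e : ℂ)) u H ≠ 0 := by
  classical
  have mixed : ∀ (s : Finset V(G)) (w : V(G) → ℕ → ℂ), (∀ v ∈ s, w v = u v) →
      (∀ v ∉ s, ∃ t : ℂ, 0 < t.re ∧ w v = fun k => t ^ k) →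
      ∑ H, weight G (fun e => (lam e : ℂ)) w H ≠ 0 := by
    intro s
    induction s using Finset.induction_on with
    | empty =>
      intro w _ hw
      choose t ht hwt using fun v => hw v (Finset.notMem_empty v)
      rw [funext hwt]
      exact sum_weight_pow_ne_zero G hlam ht
    | insert a s ha ih =>
      intro w hwu hw
      obtain ⟨p, hpd, hp⟩ := exists_umbralEval_eq_sum_weight G (fun e => (lam e : ℂ)) w a
      rw [← Function.update_eq_self a w, ← hp, hwu a (Finset.mem_insert_self a s)]
      refine umbralEval_ne_zero (hu a) (hK a) hpd fun t ht => ?_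
      rw [← umbralEval_pow, hp]
      refine ih _ (fun v hv => ?_) fun v hv => ?_
      · rw [Function.update_of_ne (ne_of_mem_of_not_mem hv ha)]
        exact hwu v (Finset.mem_insert_of_mem hv)
      · rcases eq_or_ne v a with rfl | hva
        · exact ⟨t, ht, Function.update_self ..⟩
        · rw [Function.update_of_ne hva]
          exact hw v (by simp [hv, hva])
  exact mixed Finset.univ u (fun _ _ => rfl) fun v hv => absurd (Finset.mem_univ v) hv

theorem eval_Z (lam : E(G) → ℂ) (u : V(G) → ℕ → ℂ) (x : V(G) → ℂ) :
    MvPolynomial.eval x (Z G lam u) = ∑ H, weight G lam (fun v k => u v k * x v ^ k) H := by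
  simp [Z, weight, Finset.prod_mul_distrib, mul_assoc]

end Graphs

/-! ### Sectors -/

theorem mem_sector_iff {θ : ℝ} (hθ0 : 0 ≤ θ) (hθ : θ ≤ Real.pi) {z : ℂ} :
    z ∈ sector θ ↔ ‖z‖ * Real.cos θ < z.re := by
  rcases eq_or_ne z 0 with rfl | hz
  · simp [sector]
  · rw [← Complex.norm_mul_cos_arg z, mul_lt_mul_iff_right₀ (norm_pos_iff.2 hz),
      ← Real.cos_abs (Complex.arg z),
      Real.strictAntiOn_cos.lt_iff_gt ⟨hθ0, hθ⟩ ⟨abs_nonneg _, Complex.abs_arg_le_pi z⟩]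
    exact and_iff_right hz

theorem isOpen_sector {θ : ℝ} (hθ0 : 0 ≤ θ) (hθ : θ ≤ Real.pi) : IsOpen (sector θ) := by
  have heq : sector θ = {z | ‖z‖ * Real.cos θ < z.re} :=
    Set.ext fun z => mem_sector_iff hθ0 hθ
  rw [heq]
  exact isOpen_lt (by fun_prop) Complex.continuous_re

theorem add_ofReal_mem_sector {θ r : ℝ} (hθ0 : 0 ≤ θ) (hθ : θ ≤ Real.pi) {z : ℂ}
    (hz : z ∈ sector θ) (hr : 0 ≤ r) : z + r ∈ sector θ := by
  rw [mem_sector_iff hθ0 hθ] at hz ⊢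
  have hnorm : |‖z + r‖ - ‖z‖| ≤ r := by
    simpa [abs_of_nonneg hr] using abs_norm_sub_norm_le (z + r) z
  have hcos : (‖z + r‖ - ‖z‖) * Real.cos θ ≤ r :=
    calc (‖z + r‖ - ‖z‖) * Real.cos θ ≤ |‖z + r‖ - ‖z‖| * |Real.cos θ| :=
          (le_abs_self _).trans_eq (abs_mul ..)
      _ ≤ r * 1 := mul_le_mul hnorm (Real.abs_cos_le_one θ) (abs_nonneg _) hr
      _ = r := mul_one r
  rw [Complex.add_re, Complex.ofReal_re]
  linarith

theorem ofReal_mem_sector {θ r : ℝ} (hθ : 0 < θ) (hr : 0 < r) : (r : ℂ) ∈ sector θ :=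
  ⟨Complex.ofReal_ne_zero.2 hr.ne', by rwa [Complex.arg_ofReal_of_nonneg hr.le, abs_zero]⟩

theorem mul_mem_sector {ε : ℝ} (hε : ε ≤ Real.pi / 2) {x z : ℂ} (hx : x ∈ sector ε)
    (hz0 : z ≠ 0) (hz : 0 ≤ z.re) : x * z ∈ sector (Real.pi / 2 + ε) := by
  obtain ⟨hx0, hx⟩ := hx
  have hz' := abs_le.1 (Complex.abs_arg_le_pi_div_two_iff.2 hz)
  have hx' := abs_lt.1 hx
  refine ⟨mul_ne_zero hx0 hz0, ?_⟩
  rw [Complex.arg_mul hx0 hz0 ⟨by linarith, by linarith⟩, abs_lt]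
  constructor <;> linarith

theorem cpow_one_half_mem_sector {ε : ℝ} {y : ℂ} (hy : y ∈ sector (2 * ε)) :
    y ^ (1 / 2 : ℂ) ∈ sector ε := by
  obtain ⟨hy0, hy⟩ := hy
  have him : (Complex.log y * (1 / 2 : ℂ)).im = Complex.arg y / 2 := by
    rw [mul_one_div, Complex.div_ofNat_im, Complex.log_im]
  have hlo := Complex.neg_pi_lt_arg y
  have hhi := Complex.arg_le_pi y
  rw [Complex.cpow_def_of_ne_zero hy0]
  refine ⟨Complex.exp_ne_zero _, ?_⟩
  rw [Complex.arg_exp, him, (toIocMod_eq_self Real.two_pi_pos).2 ⟨by linarith, by linarith⟩,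
    abs_div, abs_two]
  linarith

/-! ### Closedness of nonvanishing -/

section Limits

theorem norm_prod_sub_le {r : ℝ} (hr : 0 < r) {s : Multiset ℂ} (hs : ∀ z ∈ s, r ≤ ‖z‖) (t : ℂ) :
    ‖(s.map fun z => t - z).prod‖
      ≤ ‖(s.map fun z => 0 - z).prod‖ * (1 + ‖t‖ / r) ^ Multiset.card s := by
  induction s using Multiset.induction with
  | empty => simp
  | cons a s ih =>
    obtain ⟨ha, hs⟩ := Multiset.forall_mem_cons.1 hs
    have hfactor : ‖t - a‖ ≤ ‖0 - a‖ * (1 + ‖t‖ / r) := by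
      rw [zero_sub, norm_neg]
      have : ‖t‖ ≤ ‖a‖ * (‖t‖ / r) := by
        calc ‖t‖ = r * (‖t‖ / r) := by field_simp
          _ ≤ ‖a‖ * (‖t‖ / r) := by gcongr
      linarith [norm_sub_le t a]
    rw [Multiset.map_cons, Multiset.prod_cons, Multiset.map_cons, Multiset.prod_cons, norm_mul,
      norm_mul, Multiset.card_cons, pow_succ', mul_mul_mul_comm]
    exact mul_le_mul hfactor (ih hs) (norm_nonneg _) (by positivity)

theorem norm_eval_le_of_forall_ball_ne_zero {q : ℂ[X]} {n : ℕ} (hn : q.natDegree ≤ n) {r : ℝ}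
    (hr : 0 < r) (hq : ∀ t : ℂ, ‖t‖ < r → q.eval t ≠ 0) (t : ℂ) :
    ‖q.eval t‖ ≤ (1 + ‖t‖ / r) ^ n * ‖q.eval 0‖ := by
  have hroots : ∀ z ∈ q.roots, r ≤ ‖z‖ := fun z hz =>
    not_lt.1 fun h => hq z h (isRoot_of_mem_roots hz)
  rw [(IsAlgClosed.splits q).eval_eq_prod_roots, (IsAlgClosed.splits q).eval_eq_prod_roots,
    norm_mul, norm_mul, mul_left_comm, mul_comm (_ ^ n)]
  gcongr
  refine (norm_prod_sub_le hr hroots t).trans ?_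
  gcongr
  · exact le_add_of_nonneg_right (by positivity)
  · exact q.card_roots'.trans hn

variable {σ : Type*}

theorem exists_eval_add_mul_eq (F : MvPolynomial σ ℂ) (x w : σ → ℂ) :
    ∃ q : ℂ[X], q.natDegree ≤ F.totalDegree ∧
      ∀ t, q.eval t = MvPolynomial.eval (fun i => x i + w i * t) F := by
  refine ⟨MvPolynomial.aeval (fun i => C (x i) + C (w i) * X) F, ?_, fun t => ?_⟩
  · have hline : ∀ i, (C (x i) + C (w i) * X).natDegree ≤ 1 := fun i => by compute_degree
    simpa only [mul_one] using MvPolynomial.aeval_natDegree_le F le_rfl _ hline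
  · rw [← coe_aeval_eq_eval, MvPolynomial.comp_aeval_apply]
    simp [MvPolynomial.aeval_eq_eval]

/-- Restrict to the line through `x` and `y`: the zeros of the resulting polynomial in one variable
stay away from the parameter of `x`. -/
theorem exists_forall_norm_eval_le [Finite σ] {A : Set ℂ} (hA : IsOpen A) (n : ℕ) {x : σ → ℂ}
    (hx : ∀ i, x i ∈ A) (y : σ → ℂ) :
    ∃ c : ℝ, ∀ F : MvPolynomial σ ℂ, F.totalDegree ≤ n → Nonvanishing A F →
      ‖MvPolynomial.eval y F‖ ≤ c * ‖MvPolynomial.eval x F‖ := by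
  obtain ⟨r, hr, hball⟩ : ∃ r > 0, ∀ t : ℂ, ‖t‖ < r → ∀ i, x i + (y i - x i) * t ∈ A := by
    have hnear : ∀ᶠ t : ℂ in 𝓝 0, ∀ i, x i + (y i - x i) * t ∈ A := by
      refine eventually_all.2 fun i => ?_
      have hcont : ContinuousAt (fun t : ℂ => x i + (y i - x i) * t) 0 := by fun_prop
      exact hcont.eventually_mem (hA.mem_nhds (by simpa using hx i))
    obtain ⟨r, hr, h⟩ := Metric.eventually_nhds_iff.1 hnear
    exact ⟨r, hr, fun t ht => h (by simpa using ht)⟩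
  refine ⟨(1 + ‖(1 : ℂ)‖ / r) ^ n, fun F hFn hF => ?_⟩
  rcases hF with rfl | hF
  · simp
  obtain ⟨q, hqn, hq⟩ := exists_eval_add_mul_eq F x (fun i => y i - x i)
  have h := norm_eval_le_of_forall_ball_ne_zero (hqn.trans hFn) hr
    (fun t ht => (hq t).trans_ne (hF _ (hball t ht))) 1
  simpa [hq] using h

theorem isClosed_setOf_nonvanishing [Finite σ] {A : Set ℂ} (hA : IsOpen A) {T : Type*}
    [TopologicalSpace T] {F : T → MvPolynomial σ ℂ} {n : ℕ} (hn : ∀ a, (F a).totalDegree ≤ n)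
    (hF : ∀ x, Continuous fun a => MvPolynomial.eval x (F a)) :
    IsClosed {a | Nonvanishing A (F a)} := by
  choose c hc using fun (x : {x : σ → ℂ // ∀ i, x i ∈ A}) => exists_forall_norm_eval_le hA n x.2
  have heq : {a | Nonvanishing A (F a)} = ⋂ (x : {x : σ → ℂ // ∀ i, x i ∈ A}) (y : σ → ℂ),
      {a | ‖MvPolynomial.eval y (F a)‖ ≤ c x y * ‖MvPolynomial.eval x.1 (F a)‖} := by
    ext a
    simp only [Set.mem_iInter, Set.mem_ofPred_eq]
    refine ⟨fun h x y => hc x y _ (hn a) h, fun h => or_iff_not_imp_left.2 fun ha x hx hx0 => ha ?_⟩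
    refine MvPolynomial.funext fun y => ?_
    simpa [hx0] using h ⟨x, hx⟩ y
  rw [heq]
  exact isClosed_iInter fun x => isClosed_iInter fun y =>
    isClosed_le (hF y).norm (continuous_const.mul (hF x).norm)

theorem continuous_coeff_map_evalRingHom (P : ℂ[X][X]) (j : ℕ) :
    Continuous fun δ : ℂ => (P.map (evalRingHom δ)).coeff j := by
  simpa only [coeff_map, coe_evalRingHom] using (P.coeff j).continuous

/-- Shifting `K` by `δ` moves its zeros off the origin and keeps them outside the sector; the
factors `1 + δ z` raise the degree to `d`. -/
theorem exists_map_evalRingHom_zero_eq {d : ℕ} {K : ℂ[X]} (hKd : K.natDegree ≤ d) {θ : ℝ}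
    (hθ0 : 0 < θ) (hθ : θ ≤ Real.pi) (hK : ∀ z ∈ sector θ, K.eval z ≠ 0) :
    ∃ P : ℂ[X][X], P.map (evalRingHom 0) = K ∧ ∀ δ : ℝ, 0 < δ →
      (P.map (evalRingHom (δ : ℂ))).natDegree = d ∧
        ∀ z : ℂ, z = 0 ∨ z ∈ sector θ → (P.map (evalRingHom (δ : ℂ))).eval z ≠ 0 := by
  have hmap : ∀ δ : ℂ, (((K.map C).comp (X + C X) * (C X * X + 1) ^ (d - K.natDegree)).map
      (evalRingHom δ)) = K.comp (X + C δ) * (C δ * X + 1) ^ (d - K.natDegree) := by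
    intro δ
    have hC : (evalRingHom δ).comp C = RingHom.id ℂ := RingHom.ext fun z => eval_C
    simp [Polynomial.map_comp, Polynomial.map_map, hC]
  refine ⟨_, (hmap 0).trans (by simp), fun δ hδ => ?_⟩
  have hδ0 : (δ : ℂ) ≠ 0 := Complex.ofReal_ne_zero.2 hδ.ne'
  have hK0 : K ≠ 0 := fun h => hK δ (ofReal_mem_sector hθ0 hδ) (by rw [h, eval_zero])
  have hlin : (C (δ : ℂ) * X + 1).natDegree = 1 := natDegree_linear hδ0
  have hlin0 : C (δ : ℂ) * X + 1 ≠ 0 := fun h => by simp [h] at hlin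
  have hcomp0 : K.comp (X + C (δ : ℂ)) ≠ 0 := comp_X_add_C_ne_zero_iff.2 hK0
  rw [hmap]
  refine ⟨?_, fun z hz => ?_⟩
  · rw [natDegree_mul hcomp0 (pow_ne_zero _ hlin0), natDegree_comp, natDegree_X_add_C,
      natDegree_pow, hlin]
    omega
  · have hshift : ∀ r : ℝ, 0 < r → z + r ∈ sector θ := by
      intro r hr
      rcases hz with rfl | hz
      · rw [zero_add]
        exact ofReal_mem_sector hθ0 hr
      · exact add_ofReal_mem_sector hθ0.le hθ hz hr.le
    have hfactor : δ * z + 1 = δ * (z + (δ⁻¹ : ℝ)) := by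
      push_cast
      field_simp
    rw [eval_mul, eval_pow, eval_comp]
    simp only [eval_add, eval_mul, eval_X, eval_C, eval_one]
    rw [hfactor]
    exact mul_ne_zero (hK _ (hshift δ hδ))
      (pow_ne_zero _ (mul_ne_zero hδ0 (hshift _ (inv_pos.2 hδ)).1))

/-- The activity sequences `a` with `a d ≠ 0` whose key polynomial at a vertex of degree `d` has no
zeros in `S[θ] ∪ {0}`: after rescaling, Grace's theorem applies to them directly, and by density
they suffice. -/
def strictActivities (θ : ℝ) (d : ℕ) : Set (ℕ → ℂ) :=
  {a | a d ≠ 0 ∧ ∀ z : ℂ, z = 0 ∨ z ∈ sector θ → (binomialPoly d a).eval z ≠ 0}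

theorem mem_closure_strictActivities {d : ℕ} {θ : ℝ} (hθ0 : 0 < θ) (hθ : θ ≤ Real.pi)
    {a : ℕ → ℂ} (ha : ∀ z ∈ sector θ, (binomialPoly d a).eval z ≠ 0) :
    a ∈ closure (strictActivities θ d) := by
  obtain ⟨P, hP0, hP⟩ :=
    exists_map_evalRingHom_zero_eq (natDegree_binomialPoly_le d a) hθ0 hθ ha
  set b : ℂ → ℕ → ℂ := fun δ j =>
    a j + (P.map (evalRingHom δ) - binomialPoly d a).coeff j / d.choose j
  have hb0 : b 0 = a := by simp only [b, hP0, sub_self, coeff_zero, zero_div, add_zero]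
  have hb : Continuous b := by
    refine continuous_pi fun j => continuous_const.add (Continuous.div_const ?_ _)
    simp only [coeff_sub]
    exact (continuous_coeff_map_evalRingHom P j).sub continuous_const
  have hlim : Tendsto (fun δ : ℝ => b δ) (𝓝[>] 0) (𝓝 a) := by
    have := (hb.comp Complex.continuous_ofReal).tendsto 0
    rw [Function.comp_apply, Complex.ofReal_zero, hb0] at this
    exact this.mono_left nhdsWithin_le_nhds
  refine mem_closure_of_tendsto hlim ?_
  filter_upwards [self_mem_nhdsWithin] with δ hδ
  obtain ⟨hdeg, hne⟩ := hP δ hδ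
  have hbP : binomialPoly d (b δ) = P.map (evalRingHom (δ : ℂ)) :=
    binomialPoly_add_sub_div_choose a hdeg.le
  refine ⟨fun h => ?_, by rwa [hbP]⟩
  have hlead : (P.map (evalRingHom (δ : ℂ))).leadingCoeff = 0 := by
    rw [leadingCoeff, hdeg, ← hbP, coeff_binomialPoly, h, mul_zero]
  exact hne 0 (Or.inl rfl) (by rw [leadingCoeff_eq_zero.1 hlead, eval_zero])

end Limits

section Nonvanishing

variable {α β : Type*} (G : Graph α β) [Fintype V(G)] [Fintype E(G)]

theorem totalDegree_Z_le (lam : E(G) → ℂ) (u : V(G) → ℕ → ℂ) :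
    (Z G lam u).totalDegree ≤ 2 * Fintype.card E(G) := by
  refine MvPolynomial.totalDegree_finsetSum_le fun H _ => ?_
  calc (MvPolynomial.C (weight G lam u H) *
        ∏ v, (MvPolynomial.X v : MvPolynomial V(G) ℂ) ^ deg G H v).totalDegree
      ≤ 0 + ∑ v, ((MvPolynomial.X v : MvPolynomial V(G) ℂ) ^ deg G H v).totalDegree :=
        (MvPolynomial.totalDegree_mul _ _).trans (add_le_add
          (MvPolynomial.totalDegree_C _).le (MvPolynomial.totalDegree_finsetProd _ _))
    _ = 2 * H.card := by simp only [MvPolynomial.totalDegree_X_pow, sum_deg, zero_add]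
    _ ≤ 2 * Fintype.card E(G) := by gcongr; exact H.card_le_univ

theorem Z_eq_zero_of_keyPoly_eq_zero (lam : E(G) → ℂ) {u : V(G) → ℕ → ℂ} {v : V(G)}
    (hv : keyPoly G u v = 0) : Z G lam u = 0 := by
  refine Finset.sum_eq_zero fun H _ => ?_
  have hu : u v (deg G H v) = 0 := by
    have hcoeff := congrArg (coeff · (deg G H v)) hv
    simp only [keyPoly_eq_binomialPoly, coeff_binomialPoly, coeff_zero] at hcoeff
    refine (mul_eq_zero.1 hcoeff).resolve_left (Nat.cast_ne_zero.2 ?_)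
    exact (Nat.choose_pos (deg_mono G H.subset_univ v)).ne'
  rw [weight, Finset.prod_eq_zero (Finset.mem_univ v) hu, mul_zero, map_zero, zero_mul]

theorem eval_Z_ne_zero {ε : ℝ} (hε : ε ≤ Real.pi / 2) {lam : E(G) → ℝ} (hlam : ∀ e, 0 ≤ lam e)
    {u : V(G) → ℕ → ℂ}
    (hu : ∀ v, u v ∈ strictActivities (Real.pi / 2 + ε) (deg G Finset.univ v))
    {x : V(G) → ℂ} (hx : ∀ v, x v ∈ sector ε) :
    MvPolynomial.eval x (Z G (fun e => (lam e : ℂ)) u) ≠ 0 := by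
  rw [eval_Z]
  refine sum_weight_ne_zero G hlam (fun v => mul_ne_zero (hu v).1 (pow_ne_zero _ (hx v).1))
    fun v z hz => ?_
  rw [keyPoly_eq_binomialPoly, eval_binomialPoly_mul_pow]
  refine (hu v).2 _ ?_
  rcases eq_or_ne z 0 with rfl | hz0
  · exact Or.inl (mul_zero _)
  · exact Or.inr (mul_mem_sector hε (hx v) hz0 hz)

theorem continuous_eval_Z (lam : E(G) → ℂ) (x : V(G) → ℂ) :
    Continuous fun u => MvPolynomial.eval x (Z G lam u) := by
  simp only [eval_Z, weight]
  fun_prop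

theorem nonvanishing_Z {ε : ℝ} (hε0 : 0 ≤ ε) (hε : ε ≤ Real.pi / 2) {lam : E(G) → ℝ}
    (hlam : ∀ e, 0 ≤ lam e) {u : V(G) → ℕ → ℂ}
    (hK : ∀ v, Nonvanishing₁ (sector (Real.pi / 2 + ε)) (keyPoly G u v)) :
    Nonvanishing (sector ε) (Z G (fun e => (lam e : ℂ)) u) := by
  have hpi := Real.pi_pos
  by_cases hzero : ∃ v, keyPoly G u v = 0
  · obtain ⟨v, hv⟩ := hzero
    exact Or.inl (Z_eq_zero_of_keyPoly_eq_zero G _ hv)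
  rw [not_exists] at hzero
  have hclosed := isClosed_setOf_nonvanishing (isOpen_sector hε0 (by linarith))
    (totalDegree_Z_le G fun e => (lam e : ℂ)) (continuous_eval_Z G _)
  have hstrict : Set.univ.pi
      (fun v => strictActivities (Real.pi / 2 + ε) (deg G Finset.univ v))
      ⊆ {u | Nonvanishing (sector ε) (Z G (fun e => (lam e : ℂ)) u)} := fun w hw =>
    Or.inr fun x hx => eval_Z_ne_zero G hε hlam (fun v => hw v (Set.mem_univ v)) hx
  refine closure_minimal hstrict hclosed ?_
  rw [closure_pi_set]
  exact fun v _ => mem_closure_strictActivities (by linarith) (by linarith)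
    ((hK v).resolve_left (hzero v))

theorem nonvanishing_Z_uni {ε : ℝ} {lam : E(G) → ℂ} {u : V(G) → ℕ → ℂ}
    (hZ : Nonvanishing (sector ε) (Z G lam u)) :
    Nonvanishing₁ (sector (2 * ε)) (Z_uni G lam u) := by
  refine hZ.imp (fun hZ => ?_) fun hZ y hy => ?_
  · exact Polynomial.funext fun y => by rw [Z_uni_eval, hZ, map_zero, eval_zero]
  · rw [Z_uni_eval]
    exact hZ _ fun _ => cpow_one_half_mem_sector hy

end Nonvanishing

/-! ### Windows of binomial coefficients -/

theorem choose_mul_choose_add_three_lt {d k : ℕ} (h : k + 2 ≤ d) :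
    d.choose k * d.choose (k + 3) < d.choose (k + 1) * d.choose (k + 2) := by
  have hone := Nat.choose_succ_right_eq d k
  have hthree := Nat.choose_succ_right_eq d (k + 2)
  have hpos : 0 < d.choose k * d.choose (k + 2) :=
    Nat.mul_pos (Nat.choose_pos (by omega)) (Nat.choose_pos (by omega))
  have hlt : (k + 1) * (d - (k + 2)) < (k + 3) * (d - k) :=
    Nat.mul_lt_mul'' (by omega) (by omega)
  refine lt_of_mul_lt_mul_left (a := (k + 1) * (k + 3)) ?_ (Nat.zero_le _)
  calc (k + 1) * (k + 3) * (d.choose k * d.choose (k + 3))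
      = (k + 1) * d.choose k * (d.choose (k + 2 + 1) * (k + 2 + 1)) := by ring
    _ = (k + 1) * (d - (k + 2)) * (d.choose k * d.choose (k + 2)) := by
        rw [hthree]
        ring
    _ < (k + 3) * (d - k) * (d.choose k * d.choose (k + 2)) :=
        Nat.mul_lt_mul_of_pos_right hlt hpos
    _ = (k + 3) * d.choose (k + 2) * (d.choose k * (d - k)) := by ring
    _ = (k + 1) * (k + 3) * (d.choose (k + 1) * d.choose (k + 2)) := by
        rw [← hone]
        ring

/-- The Hurwitz criterion for a cubic. A zero `z` satisfies
`(a * conj z + c * |z|² * z) * (c + e * z) = -(b * c - a * e) * |z|²`, whereas both factors on the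
left have nonnegative real part. -/
theorem cubic_ne_zero {a b c e : ℝ} (ha : 0 < a) (hb : 0 ≤ b) (hc : 0 ≤ c) (he : 0 ≤ e)
    (h : c = 0 ∧ e = 0 ∨ a * e < b * c) {z : ℂ} (hz : 0 ≤ z.re) :
    (a + b * z + c * z ^ 2 + e * z ^ 3 : ℂ) ≠ 0 := by
  intro h0
  rcases h with ⟨rfl, rfl⟩ | h
  · have hre := congrArg Complex.re h0
    simp only [Complex.ofReal_zero, zero_mul, add_zero, Complex.add_re, Complex.re_ofReal_mul,
      Complex.ofReal_re, Complex.zero_re] at hre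
    linarith [mul_nonneg hb hz]
  have hc0 : 0 < c := pos_of_mul_pos_right ((mul_nonneg ha.le he).trans_lt h) hb
  have hz0 : z ≠ 0 := by
    rintro rfl
    simp [ha.ne'] at h0
  have hκ : 0 < (b * c - a * e) * Complex.normSq z :=
    mul_pos (sub_pos.2 h) (Complex.normSq_pos.2 hz0)
  have hleft : 0 ≤ (a * (starRingEnd ℂ) z + (c * Complex.normSq z : ℝ) * z).re := by
    rw [Complex.add_re, Complex.re_ofReal_mul, Complex.re_ofReal_mul, Complex.conj_re]
    have := Complex.normSq_nonneg z
    positivity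
  have hright : 0 < (c + e * z).re := by
    rw [Complex.add_re, Complex.re_ofReal_mul, Complex.ofReal_re]
    positivity
  refine ofReal_add_mul_ne_zero hκ hleft hright ?_
  push_cast
  rw [Complex.normSq_eq_conj_mul_self]
  linear_combination c * (starRingEnd ℂ) z * h0

theorem sum_choose_add_mul_pow_ne_zero {d k m : ℕ} (hk : k ≤ d) (hm : m ≤ 3) {z : ℂ}
    (hz : 0 ≤ z.re) : ∑ i ∈ Finset.range (m + 1), (d.choose (k + i) : ℂ) * z ^ i ≠ 0 := by
  have hcubic : ∀ b c e : ℕ, c = 0 ∧ e = 0 ∨ d.choose k * e < b * c →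
      (d.choose k + b * z + c * z ^ 2 + e * z ^ 3 : ℂ) ≠ 0 := by
    intro b c e h
    have := cubic_ne_zero (a := d.choose k) (b := b) (c := c) (e := e)
      (Nat.cast_pos.2 (Nat.choose_pos hk)) b.cast_nonneg c.cast_nonneg e.cast_nonneg
      (by exact_mod_cast h) hz
    exact_mod_cast this
  have hchoose : d.choose (k + 2) = 0 ∧ d.choose (k + 3) = 0 ∨
      d.choose k * d.choose (k + 3) < d.choose (k + 1) * d.choose (k + 2) := by
    rcases lt_or_ge d (k + 2) with hd | hd
    · exact Or.inl ⟨Nat.choose_eq_zero_of_lt hd, Nat.choose_eq_zero_of_lt (by omega)⟩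
    · exact Or.inr (choose_mul_choose_add_three_lt hd)
  interval_cases m
  · simpa using hcubic 0 0 0 (Or.inl ⟨rfl, rfl⟩)
  · simpa [Finset.sum_range_succ] using hcubic (d.choose (k + 1)) 0 0 (Or.inl ⟨rfl, rfl⟩)
  · simpa [Finset.sum_range_succ] using hcubic (d.choose (k + 1)) (d.choose (k + 2)) 0
      (hchoose.imp (⟨·.1, rfl⟩) (Nat.zero_le _).trans_lt)
  · simpa [Finset.sum_range_succ] using
      hcubic (d.choose (k + 1)) (d.choose (k + 2)) (d.choose (k + 3)) hchoose

/-- The activities of a vertex that admits the degrees `k, …, l`. -/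
def windowActivity (k l : ℕ) : ℕ → ℂ :=
  fun j => if k ≤ j ∧ j ≤ l then 1 else 0

theorem keyPoly_indicatorActivity {α β : Type*} (G : Graph α β) [Fintype E(G)] (f g : V(G) → ℕ)
    (v : V(G)) : keyPoly G (indicatorActivity f g) v
      = binomialPoly (deg G Finset.univ v) (windowActivity (f v) (g v)) :=
  rfl

theorem binomialPoly_windowActivity_add (d k m : ℕ) :
    binomialPoly d (windowActivity k (k + m))
      = X ^ k * ∑ i ∈ Finset.range (m + 1), C (d.choose (k + i) : ℂ) * X ^ i := by
  ext j
  rw [coeff_binomialPoly, windowActivity, coeff_X_pow_mul']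
  simp only [finsetSum_coeff, coeff_C_mul_X_pow, Finset.sum_ite_eq, Finset.mem_range]
  split_ifs with h₁ h₂ h₃ <;> first | omega | simp [*]

theorem binomialPoly_windowActivity_eq_zero {d k l : ℕ} (h : d < k ∨ l < k) :
    binomialPoly d (windowActivity k l) = 0 := by
  ext j
  rw [coeff_binomialPoly, windowActivity, coeff_zero]
  split_ifs with hj
  · rw [Nat.choose_eq_zero_of_lt (by omega), Nat.cast_zero, zero_mul]
  · rw [mul_zero]

theorem nonvanishing₁_binomialPoly_windowActivity (d : ℕ) {k l : ℕ} (hl : l ≤ k + 3) :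
    Nonvanishing₁ {z | z ≠ 0 ∧ 0 ≤ z.re} (binomialPoly d (windowActivity k l)) := by
  rcases lt_or_ge l k with hkl | hkl
  · exact Or.inl (binomialPoly_windowActivity_eq_zero (Or.inr hkl))
  rcases lt_or_ge d k with hkd | hkd
  · exact Or.inl (binomialPoly_windowActivity_eq_zero (Or.inl hkd))
  obtain ⟨m, rfl⟩ := Nat.exists_eq_add_of_le hkl
  refine Or.inr fun z hz => ?_
  rw [binomialPoly_windowActivity_add, eval_mul, eval_pow, eval_X]
  refine mul_ne_zero (pow_ne_zero _ hz.1) ?_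
  simpa [eval_finsetSum] using sum_choose_add_mul_pow_ne_zero hkd (by omega) hz.2

theorem eventually_nonvanishing₁_sector {K : ℂ[X]}
    (hK : Nonvanishing₁ {z | z ≠ 0 ∧ 0 ≤ z.re} K) :
    ∀ᶠ ε : ℝ in 𝓝[>] 0, Nonvanishing₁ (sector (Real.pi / 2 + ε)) K := by
  rcases hK with hK0 | hK
  · exact Eventually.of_forall fun _ => Or.inl hK0
  have hroots : ∀ᶠ ε : ℝ in 𝓝[>] 0, ∀ ρ ∈ K.roots.toFinset, ρ ∉ sector (Real.pi / 2 + ε) := by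
    refine (eventually_all_finset _).2 fun ρ hρ => ?_
    rcases eq_or_ne ρ 0 with rfl | hρ0
    · exact Eventually.of_forall fun _ h => h.1 rfl
    have harg : Real.pi / 2 < |Complex.arg ρ| := by
      by_contra! h
      exact hK ρ ⟨hρ0, Complex.abs_arg_le_pi_div_two_iff.1 h⟩
        (isRoot_of_mem_roots (Multiset.mem_toFinset.1 hρ))
    filter_upwards [nhdsWithin_le_nhds (Iio_mem_nhds (sub_pos.2 harg))] with ε hε h
    linarith [h.2, Set.mem_Iio.1 hε]
  have hK0 : K ≠ 0 := fun h => hK 1 (by simp) (by rw [h, eval_zero])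
  filter_upwards [hroots] with ε hε
  exact Or.inr fun z hz h0 => hε z (by simpa using ⟨hK0, h0⟩) hz

theorem exists_nonvanishing₁_sector_windowActivity (Δ : ℕ) : ∃ ε : ℝ, 0 < ε ∧ ε ≤ Real.pi / 2 ∧
    ∀ d ≤ Δ, ∀ k l, l ≤ k + 3 →
      Nonvanishing₁ (sector (Real.pi / 2 + ε)) (binomialPoly d (windowActivity k l)) := by
  have hfinite : ∀ᶠ ε : ℝ in 𝓝[>] 0, ∀ d ∈ Finset.range (Δ + 1), ∀ k ∈ Finset.range (Δ + 1),
      ∀ l ∈ Finset.range (k + 4),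
        Nonvanishing₁ (sector (Real.pi / 2 + ε)) (binomialPoly d (windowActivity k l)) := by
    simp only [eventually_all_finset]
    exact fun d _ k _ l hl => eventually_nonvanishing₁_sector
      (nonvanishing₁_binomialPoly_windowActivity d (Nat.lt_succ_iff.1 (Finset.mem_range.1 hl)))
  obtain ⟨ε, hε, hε0, hεπ⟩ := (hfinite.and (Ioc_mem_nhdsGT Real.pi_div_two_pos)).exists
  refine ⟨ε, hε0, hεπ, fun d hd k l hl => ?_⟩
  rcases lt_or_ge d k with hkd | hkd
  · exact Or.inl (binomialPoly_windowActivity_eq_zero (Or.inl hkd))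
  · exact hε d (Finset.mem_range.2 (by omega)) k (Finset.mem_range.2 (by omega)) l
      (Finset.mem_range.2 (by omega))

end SpanningSubgraph

theorem mainTheorem7 (Δ : ℕ) :
    ∃ ε : ℝ, 0 < ε ∧ ε ≤ Real.pi / 2 ∧
      ∀ (α : Type*) (β : Type*) (G : Graph α β) [Fintype V(G)] [Fintype E(G)]
        (lam : E(G) → ℝ) (f g : V(G) → ℕ),
        (∀ e, 0 ≤ lam e) →
        (∀ v, SpanningSubgraph.deg G Finset.univ v ≤ Δ) →
        (∀ v, f v ≤ g v ∧ g v ≤ f v + 3) →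
        (∀ v, SpanningSubgraph.Nonvanishing₁ (SpanningSubgraph.sector (Real.pi / 2 + ε))
          (SpanningSubgraph.keyPoly G (SpanningSubgraph.indicatorActivity f g) v)) ∧
        SpanningSubgraph.Nonvanishing (SpanningSubgraph.sector ε)
          (SpanningSubgraph.Z G (fun e => (lam e : ℂ))
            (SpanningSubgraph.indicatorActivity f g)) ∧
        SpanningSubgraph.Nonvanishing₁ (SpanningSubgraph.sector (2 * ε))
          (SpanningSubgraph.Z_uni G (fun e => (lam e : ℂ))
            (SpanningSubgraph.indicatorActivity f g)) := by
  obtain ⟨ε, hε0, hε, hwindow⟩ := SpanningSubgraph.exists_nonvanishing₁_sector_windowActivity Δ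
  refine ⟨ε, hε0, hε, fun α β G _ _ lam f g hlam hdeg hfg => ?_⟩
  have hK : ∀ v, SpanningSubgraph.Nonvanishing₁ (SpanningSubgraph.sector (Real.pi / 2 + ε))
      (SpanningSubgraph.keyPoly G (SpanningSubgraph.indicatorActivity f g) v) :=
    fun v => by
      rw [SpanningSubgraph.keyPoly_indicatorActivity]
      exact hwindow _ (hdeg v) (f v) (g v) (hfg v).2
  have hZ := SpanningSubgraph.nonvanishing_Z G hε0.le hε hlam hK
  exact ⟨hK, hZ, SpanningSubgraph.nonvanishing_Z_uni G hZ⟩
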